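/- For complex numbers $c_0,\dots,c_{n-1}$ let $\mathrm{circ}_n(c_0,c_1,\dots,c_{n-1})$ denote the $n\times n$ circulant matrix with first row $(c_0,c_1,\dots,c_{n-1})$, i.e. with $(i,j)$ entry $c_{(j-i)\bmod n}$ for $0\le i,j\le n-1$. Let $n\ge 2$ be an integer, let $d\ge 0$ be a real number that is not an odd integer, and let $C=\mathrm{circ}_n(c_0,c_1,\dots,c_{n-1})$ be a Hermitian circulant matrix such that $c_0=d$, $c_j\in\{1,-1,\mathrm{i},-\mathrm{i}\}$ for all $j=1,\dots,n-1$, and $CC^*=(d^2+n-1)I$. Then $n=2d+2$ and all entries of $C$ are real. Moreover: - if $d$ is an even integer, then $C=\mathrm{circ}_{2d+2}(d,-1,-1,\dots,-1)$ or $C=\mathrm{circ}_{2d+2}(d,1,-1,1,-1,1,\dots,-1,1)$ (that is, $c_j=(-1)^{j+1}$ for $1\le j\le n-1$); - if $d$ is a half-integer, i.e. $d-\tfrac12\in\mathbb{Z}$, then $C=\mathrm{circ}_{2d+2}(d,-1,-1,\dots,-1)$. -/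

import Mathlib

/-- The circulant matrix `circ_n(c₀, …, c_{n-1})` of order `n` whose first row (generator) is
`(c₀, …, c_{n-1})`: its `(i, j)` entry is `c_{j - i mod n}`. (This is the transpose of
`Matrix.circulant c`, which has `c` as its first column.) -/
def circ {n : ℕ} (c : Fin n → ℂ) : Matrix (Fin n) (Fin n) ℂ :=
  (Matrix.circulant c).transpose

/-- The conditions `c₀ = d ≥ 0`, `|c_j| = 1` for `j ≠ 0`, and `C C* = (d² + n - 1) I`
on the circulant matrix `C = circ_n(c₀, …, c_{n-1})`. -/
structure CircConditions {n : ℕ} [NeZero n] (d : ℝ) (c : Fin n → ℂ) : Prop where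
  nonneg : 0 ≤ d
  diag : c 0 = (d : ℂ)
  unimodular : ∀ j : Fin n, j ≠ 0 → ‖c j‖ = 1
  orthogonal : circ c * (circ c).conjTranspose =
    ((d : ℂ) ^ 2 + (n : ℂ) - 1) • (1 : Matrix (Fin n) (Fin n) ℂ)

/-- The generator `(d, -1, -1, …, -1)` of length `n`. -/
def genNeg (n : ℕ) (d : ℝ) : Fin n → ℂ :=
  fun j => if j.val = 0 then (d : ℂ) else -1

/-- The generator `(d, 1, -1, 1, -1, …)` of length `n`: entry `1` at odd positions and `-1` at
even positions other than `0`. -/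
def genAlt (n : ℕ) (d : ℝ) : Fin n → ℂ :=
  fun j => if j.val = 0 then (d : ℂ) else if j.val % 2 = 1 then 1 else -1

/-! Hermitian symmetry turns row orthogonality into vanishing self-convolutions of `c` at `k ≠ 0`.
With `c j = a j + b j * I` off `0` and `a 0 = b 0 = 0`, this reads `2 * d * c k` plus the
convolution of the off-diagonal part equals `0`, so `D = 2 * d` is an integer. The terms at `j` and
`k - j` agree, which yields congruences modulo 4 or 8.

For odd `n`, `four_dvd_of_conv` makes every `D * a k` odd, so `b = 0`; a congruence modulo 4 makes
`a` constant, and the convolution forces `-1`. For even `n`, the position `n / 2` gives `D` even,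
hence `d` even, and then `b = 0`; modulo 8, `a` is constant on odd positions. The convolution at an
odd position and the sum of all convolutions fix `n` and the even positions. -/

/-- If a symmetric integer function under an involution has values divisible by `M`, and by `2 * M`
at the fixed points, then its sum is divisible by `2 * M`. -/
theorem two_mul_dvd_sum_of_involution {α : Type*} [DecidableEq α] (s : Finset α) (σ : α → α)
    (hs : ∀ x ∈ s, σ x ∈ s) (hσ : ∀ x, σ (σ x) = x) (M : ℤ) (f : α → ℤ)
    (hf : ∀ x, f (σ x) = f x) (hM : ∀ x ∈ s, M ∣ f x)
    (hfix : ∀ x ∈ s, σ x = x → 2 * M ∣ f x) : 2 * M ∣ ∑ x ∈ s, f x := by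
  rcases eq_or_ne M 0 with rfl | hM0
  · rw [Finset.sum_eq_zero fun x hx => zero_dvd_iff.mp (hM x hx)]
    simp
  have hq : ∀ x ∈ s, f x = M * (f x / M) := fun x hx => (Int.mul_ediv_cancel' (hM x hx)).symm
  rw [Finset.sum_congr rfl hq, ← Finset.mul_sum, mul_comm 2 M]
  refine mul_dvd_mul_left M ((ZMod.intCast_zmod_eq_zero_iff_dvd _ 2).mp ?_)
  push_cast
  refine Finset.sum_involution (fun x _ => σ x) ?_ ?_ hs (fun x _ => hσ x)
  · intro x _
    rw [hf, CharTwo.add_self_eq_zero]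
  · intro x hx hne heq
    refine hne ((ZMod.intCast_zmod_eq_zero_iff_dvd _ 2).mpr ?_)
    obtain ⟨q, hq⟩ := hfix x hx heq
    refine ⟨q, ?_⟩
    rw [hq, mul_comm 2 M, mul_assoc, Int.mul_ediv_cancel_left _ hM0]
    rfl

/-! ### Congruences for self-convolutions on a finite abelian group -/

section Convolution

variable {G : Type*} [AddCommGroup G] [Fintype G]

/-- Reindexing a sum over a finite group by `j ↦ k - j`. -/
theorem sum_sub_left_eq {M : Type*} [AddCommMonoid M] (k : G) (g : G → M) :
    ∑ j, g (k - j) = ∑ j, g j :=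
  (Equiv.subLeft k).sum_comp g

variable [DecidableEq G]

/-- A function that is congruent modulo `M` to `g j + g (k - j) + r` off `0` and `k`, and modulo
`2 * M` at the `j` with `k - j = j`, has the corresponding sum modulo `2 * M`. -/
theorem two_mul_dvd_sum_sub {k : G} (hk : k ≠ 0) (M r : ℤ) (P g : G → ℤ)
    (hP : ∀ j, P (k - j) = P j) (hP0 : P 0 = 0) (hg0 : g 0 = 0)
    (hM : ∀ j, j ≠ 0 → k - j ≠ 0 → M ∣ P j - (g j + g (k - j) + r))
    (hfix : ∀ j, j ≠ 0 → k - j = j → 2 * M ∣ P j - (g j + g j + r)) :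
    2 * M ∣ ∑ j, P j - (2 * (∑ j, g j - g k) + r * ((Fintype.card G : ℤ) - 2)) := by
  have hPk : P k = 0 := by rw [← hP, sub_self, hP0]
  have key := two_mul_dvd_sum_of_involution ({0, k}ᶜ : Finset G) (fun j => k - j)
    (by
      intro x hx
      simp only [Finset.mem_compl, Finset.mem_insert, Finset.mem_singleton, not_or] at hx ⊢
      exact ⟨fun h => hx.2 (sub_eq_zero.mp h).symm, fun h => hx.1 (by simpa using h)⟩)
    (fun x => sub_sub_cancel k x) M (fun j => P j - (g j + g (k - j) + r))
    (fun x => by rw [hP, sub_sub_cancel, add_comm (g (k - x))])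
    (by
      intro x hx
      simp only [Finset.mem_compl, Finset.mem_insert, Finset.mem_singleton, not_or] at hx
      exact hM x hx.1 (fun h => hx.2 (sub_eq_zero.mp h).symm))
    (by
      intro x hx h
      simp only [Finset.mem_compl, Finset.mem_insert, Finset.mem_singleton, not_or] at hx
      have := hfix x hx.1 h
      rwa [h])
  have hsplit := Finset.sum_add_sum_compl ({0, k} : Finset G)
    (fun j => P j - (g j + g (k - j) + r))
  rw [Finset.sum_pair hk.symm] at hsplit
  have htot : ∑ j, (P j - (g j + g (k - j) + r)) =
      ∑ j, P j - (2 * ∑ j, g j + r * (Fintype.card G : ℤ)) := by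
    rw [Finset.sum_sub_distrib, Finset.sum_add_distrib, Finset.sum_add_distrib,
      sum_sub_left_eq k g]
    simp only [Finset.sum_const, Finset.card_univ, nsmul_eq_mul]
    ring
  rw [htot] at hsplit
  simp only [sub_zero, sub_self, hP0, hPk, hg0] at hsplit
  convert key using 1
  linarith

/-- The parity constraint on the types of the entries: `a + b i` has values in the fourth roots of
unity off `0`, vanishes at `0`, and its self-convolution at `k` has real part `-D * a k`. -/
theorem four_dvd_of_conv {k : G} (hk : k ≠ 0) (D : ℤ) (a b : G → ℤ) (ha0 : a 0 = 0) (hb0 : b 0 = 0)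
    (hab : ∀ j, j ≠ 0 → a j ^ 2 + b j ^ 2 = 1)
    (hre : D * a k + ∑ j, (a j * a (k - j) - b j * b (k - j)) = 0) :
    4 ∣ D * a k + ((Fintype.card G : ℤ) - 2) + 2 * ∑ j, b j ^ 2 - 2 * b k ^ 2 := by
  have hodd : ∀ j, j ≠ 0 → Odd (a j + b j) := fun j hj => by
    have h : Odd (a j ^ 2 + b j ^ 2) := by rw [hab j hj]; exact odd_one
    simpa [Int.odd_add, Int.odd_pow, Int.even_pow] using h
  -- As `a ≡ 1 + b` modulo 2, `a * a' - b * b' ≡ 1 + b ^ 2 + b' ^ 2`.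
  have key := two_mul_dvd_sum_sub hk 2 1 (fun j => a j * a (k - j) - b j * b (k - j))
    (fun j => b j ^ 2) (fun j => by simp only [sub_sub_cancel]; ring) (by simp [ha0, hb0])
    (by simp [hb0])
    (by
      intro j hj hkj
      obtain ⟨u, hu⟩ := hodd j hj
      obtain ⟨v, hv⟩ := hodd _ hkj
      obtain ⟨x, hx⟩ := Int.even_mul_succ_self (b j)
      obtain ⟨y, hy⟩ := Int.even_mul_succ_self (b (k - j))
      rw [show a j = 2 * u + 1 - b j by linarith,
        show a (k - j) = 2 * v + 1 - b (k - j) by linarith]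
      refine ⟨2 * u * v + u - u * b (k - j) + v - b j * v - x - y, ?_⟩
      linear_combination -hx - hy)
    (by
      intro j hj h
      refine ⟨-b j ^ 2, ?_⟩
      simp only [h]
      linear_combination hab j hj)
  obtain ⟨q, hq⟩ := key
  exact ⟨-q, by linear_combination hre - hq⟩


theorem eq_zero_and_eq_one_or_of_even {x y : ℤ} (h : x ^ 2 + y ^ 2 = 1) (hy : Even y) :
    y = 0 ∧ (x = 1 ∨ x = -1) := by
  obtain ⟨u, rfl⟩ := hy
  have hu : u = 0 := by
    by_contra hne
    have : 0 < u ^ 2 := by positivity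
    nlinarith [sq_nonneg x]
  subst hu
  refine ⟨rfl, sq_eq_sq_iff_eq_or_eq_neg.mp ?_⟩
  linarith

/-- For real sign patterns, entries can be compared modulo `4` through their convolutions. -/
theorem two_mul_dvd_of_real_conv {k : G} (hk : k ≠ 0) (M D : ℤ) (a : G → ℤ) (ha0 : a 0 = 0)
    (ha : ∀ j, j ≠ 0 → a j = 1 ∨ a j = -1) (hM : M ∣ 4)
    (hfix : ∀ j, k - j = j → 2 * M ∣ 4)
    (hre : D * a k + ∑ j, a j * a (k - j) = 0) :
    2 * M ∣ D * a k + 2 * (∑ j, a j - a k) - ((Fintype.card G : ℤ) - 2) := by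
  -- For signs `x`, `y`, `(x - 1) * (y - 1)` is divisible by 4.
  have h4 : ∀ i j, i ≠ 0 → j ≠ 0 → 4 ∣ a i * a j - (a i + a j + -1) := fun i j hi hj => by
    rcases ha i hi with h | h <;> rcases ha j hj with h' | h' <;> rw [h, h'] <;> norm_num
  obtain ⟨q, hq⟩ := two_mul_dvd_sum_sub hk M (-1) (fun j => a j * a (k - j)) a
    (fun j => by simp only [sub_sub_cancel]; ring) (by simp [ha0]) ha0
    (fun j hj hkj => hM.trans (h4 _ _ hj hkj))
    (fun j hj h => (hfix j h).trans (by simpa only [h] using h4 j j hj hj))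
  exact ⟨-q, by linear_combination hre - hq⟩

/-! ### Groups of odd order -/

/-- A solution of the convolution equations over a group of odd order is constantly `-1`
off `0`. -/
theorem eq_neg_one_of_odd_card (hodd : Odd (Fintype.card G)) (hcard : 2 ≤ Fintype.card G)
    (D : ℤ) (hD : 0 ≤ D) (a b : G → ℤ) (ha0 : a 0 = 0) (hb0 : b 0 = 0)
    (hab : ∀ j, j ≠ 0 → a j ^ 2 + b j ^ 2 = 1)
    (hre : ∀ k, k ≠ 0 → D * a k + ∑ j, (a j * a (k - j) - b j * b (k - j)) = 0) :
    (Fintype.card G : ℤ) = D + 2 ∧ ∀ j, j ≠ 0 → a j = -1 ∧ b j = 0 := by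
  obtain ⟨p, hp⟩ := hodd
  have hp' : (Fintype.card G : ℤ) = 2 * p + 1 := by exact_mod_cast hp
  have hDa : ∀ k, k ≠ 0 → Odd D ∧ Odd (a k) := fun k hk => by
    obtain ⟨q, hq⟩ := four_dvd_of_conv hk D a b ha0 hb0 hab (hre k hk)
    exact Int.odd_mul.mp ⟨2 * q - p - ∑ j, b j ^ 2 + b k ^ 2, by linarith⟩
  have hreal : ∀ k, k ≠ 0 → b k = 0 ∧ (a k = 1 ∨ a k = -1) := fun k hk => by
    refine eq_zero_and_eq_one_or_of_even (hab k hk) ?_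
    have h1 : ¬ Even (a k ^ 2 + b k ^ 2) := by rw [hab k hk]; decide
    have h2 : Odd (a k ^ 2) := (hDa k hk).2.pow
    by_contra hb
    exact h1 (h2.add_odd (Int.not_even_iff_odd.mp hb).pow)
  have hb : ∀ k, b k = 0 := fun k => by
    by_cases hk : k = 0
    · rw [hk, hb0]
    · exact (hreal k hk).1
  simp only [hb, mul_zero, sub_zero] at hre
  have : Nontrivial G := Fintype.one_lt_card_iff_nontrivial.mp hcard
  obtain ⟨l, hl⟩ := exists_ne (0 : G)
  obtain ⟨e, he⟩ := (hDa l hl).1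
  -- Comparing `k` with `l` gives `4 ∣ (D - 2) * (a k - a l)` with `D` odd.
  have hconst : ∀ k, k ≠ 0 → a k = a l := fun k hk => by
    obtain ⟨q, hq⟩ := two_mul_dvd_of_real_conv hk 2 D a ha0 (fun j hj => (hreal j hj).2)
      (by norm_num) (fun _ _ => by norm_num) (hre k hk)
    obtain ⟨q', hq'⟩ := two_mul_dvd_of_real_conv hl 2 D a ha0 (fun j hj => (hreal j hj).2)
      (by norm_num) (fun _ _ => by norm_num) (hre l hl)
    rcases (hreal k hk).2 with h | h <;> rcases (hreal l hl).2 with h' | h' <;>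
      rw [h] at hq ⊢ <;> rw [h'] at hq' ⊢ <;> omega
  have hsum : ∑ j, a j * a (l - j) = (Fintype.card G : ℤ) - 2 := by
    have hterm : ∀ j ∈ ({0, l}ᶜ : Finset G), a j * a (l - j) = 1 := fun j hj => by
      simp only [Finset.mem_compl, Finset.mem_insert, Finset.mem_singleton, not_or] at hj
      rw [hconst j hj.1, hconst (l - j) (fun h => hj.2 (sub_eq_zero.mp h).symm)]
      rcases (hreal l hl).2 with h | h <;> rw [h] <;> norm_num
    rw [← Finset.sum_add_sum_compl ({0, l} : Finset G), Finset.sum_congr rfl hterm,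
      Finset.sum_pair hl.symm, Finset.sum_const, Finset.card_compl, Finset.card_pair hl.symm]
    simp [ha0, Nat.cast_sub hcard]
  have hl' := hre l hl
  rw [hsum] at hl'
  have hneg : a l = -1 := by
    rcases (hreal l hl).2 with h | h
    · rw [h] at hl'
      omega
    · exact h
  rw [hneg] at hl'
  exact ⟨by linarith, fun j hj => ⟨(hconst j hj).trans hneg, hb j⟩⟩

/-! ### Groups of even order -/

/-- A solution of the convolution equations over a group of even order is real, and `4` divides
twice its diagonal entry. -/
theorem even_and_real_of_involution {m : G} (hm : m ≠ 0) (hm2 : -m = m)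
    (heven : Even (Fintype.card G)) (D : ℤ) (hD : ∀ q, D = 2 * q → Even q)
    (a b : G → ℤ) (ha0 : a 0 = 0) (hb0 : b 0 = 0)
    (hab : ∀ j, j ≠ 0 → a j ^ 2 + b j ^ 2 = 1) (hb_neg : ∀ j, b (-j) = -b j)
    (hre : ∀ k, k ≠ 0 → D * a k + ∑ j, (a j * a (k - j) - b j * b (k - j)) = 0) :
    4 ∣ D ∧ (∀ j, b j = 0) ∧ ∀ j, j ≠ 0 → a j = 1 ∨ a j = -1 := by
  obtain ⟨p, hp⟩ := heven
  have hp' : (Fintype.card G : ℤ) = p + p := by exact_mod_cast hp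
  have hbm : b m = 0 := by
    have := hb_neg m
    rw [hm2] at this
    omega
  have key := fun k hk => four_dvd_of_conv (k := k) hk D a b ha0 hb0 hab (hre k hk)
  obtain ⟨q, hq⟩ := key m hm
  rw [hbm] at hq
  have ham := (eq_zero_and_eq_one_or_of_even (hab m hm) (by simp [hbm])).2
  have h2 : 2 ∣ D := by
    rcases ham with h | h <;> rw [h] at hq <;> omega
  obtain ⟨d, hd⟩ := h2
  obtain ⟨e, he⟩ := hD d hd
  have hreal : ∀ k, k ≠ 0 → b k = 0 ∧ (a k = 1 ∨ a k = -1) := fun k hk => by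
    refine eq_zero_and_eq_one_or_of_even (hab k hk) ?_
    obtain ⟨q', hq'⟩ := key k hk
    -- The congruences at `k` and `m` differ by `D * (a k - a m) - 2 * b k ^ 2`, where `4 ∣ D`.
    have : Even (b k ^ 2) := ⟨e * a k - e * a m - q' + q, by subst hd he; linarith⟩
    exact (Int.even_pow.mp this).1
  refine ⟨⟨e, by omega⟩, fun j => ?_, fun j hj => (hreal j hj).2⟩
  by_cases hj : j = 0
  · rw [hj, hb0]
  · exact (hreal j hj).1

/-- The sum of all convolution equations. -/
theorem sq_sum_of_real_conv (D : ℤ) (a : G → ℤ) (ha0 : a 0 = 0)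
    (ha : ∀ j, j ≠ 0 → a j = 1 ∨ a j = -1) (ha_neg : ∀ j, a (-j) = a j)
    (hre : ∀ k, k ≠ 0 → D * a k + ∑ j, a j * a (k - j) = 0) :
    D * ∑ j, a j + (∑ j, a j) ^ 2 = (Fintype.card G : ℤ) - 1 := by
  have h0 : ∑ j, a j * a (0 - j) = (Fintype.card G : ℤ) - 1 := by
    have hterm : ∀ j ∈ ({0}ᶜ : Finset G), a j * a (0 - j) = 1 := fun j hj => by
      rw [zero_sub, ha_neg]
      rcases ha j (by simpa using hj) with h | h <;> rw [h] <;> norm_num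
    rw [← Finset.sum_add_sum_compl ({0} : Finset G), Finset.sum_congr rfl hterm,
      Finset.sum_singleton, Finset.sum_const, Finset.card_compl, Finset.card_singleton]
    simp [ha0, Nat.cast_sub (Fintype.card_pos (α := G))]
  have htot : ∑ k, (D * a k + ∑ j, a j * a (k - j)) = D * ∑ j, a j + (∑ j, a j) ^ 2 := by
    rw [Finset.sum_add_distrib, Finset.mul_sum, Finset.sum_comm, sq, Finset.sum_mul_sum]
    congr 1
    refine Finset.sum_congr rfl fun j _ => ?_
    exact (Equiv.subRight j).sum_comp (fun x => a j * a x)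
  rw [← htot, Finset.sum_eq_single 0 (fun k _ hk => hre k hk) (by simp), h0, ha0]
  ring

/-- A real solution of the convolution equations over a group with a character `π` onto `ZMod 2`,
with the diagonal entry `d` even, is `-1` on the kernel of `π` and constant off it. -/
theorem eq_of_real_conv (π : G →+ ZMod 2) {e : G} (he : π e = 1) (d : ℤ) (hd : Even d)
    (hd0 : 0 ≤ d) (a : G → ℤ) (ha0 : a 0 = 0) (ha : ∀ j, j ≠ 0 → a j = 1 ∨ a j = -1)
    (ha_neg : ∀ j, a (-j) = a j)
    (hre : ∀ k, k ≠ 0 → 2 * d * a k + ∑ j, a j * a (k - j) = 0) :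
    (Fintype.card G : ℤ) = 2 * d + 2 ∧ (a e = 1 ∨ a e = -1) ∧
      ∀ j, j ≠ 0 → a j = if π j = 0 then -1 else a e := by
  have h01 : ∀ x : ZMod 2, x ≠ 0 → x = 1 := by decide
  have hne : ∀ k, π k = 1 → k ≠ 0 := by
    rintro k hk rfl
    simp at hk
  -- Vacuous: a fixed point has `k = j + j`, so `π k = 0`.
  have hnofix : ∀ k, π k = 1 → ∀ j, k - j = j → (2 * 4 : ℤ) ∣ 4 := fun k hk j hj => by
    have h := congrArg π (sub_eq_iff_eq_add.mp hj)
    rw [map_add, CharTwo.add_self_eq_zero, hk] at h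
    exact absurd h one_ne_zero
  -- Here `8 ∣ 2 * (d - 1) * (a k - a e)` with `d - 1` odd.
  have hconst : ∀ k, π k = 1 → a k = a e := fun k hk => by
    obtain ⟨q, hq⟩ := two_mul_dvd_of_real_conv (hne k hk) 4 (2 * d) a ha0 ha dvd_rfl
      (hnofix k hk) (hre k (hne k hk))
    obtain ⟨q', hq'⟩ := two_mul_dvd_of_real_conv (hne e he) 4 (2 * d) a ha0 ha dvd_rfl
      (hnofix e he) (hre e (hne e he))
    obtain ⟨u, hu⟩ := hd
    rcases ha k (hne k hk) with h | h <;> rcases ha e (hne e he) with h' | h' <;>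
      rw [h] at hq ⊢ <;> rw [h'] at hq' ⊢ <;> omega
  set o : G → ℤ := fun j => if π j = 0 then 0 else 1 with ho
  have ho_sub : ∀ j, o (e - j) = 1 - o j := fun j => by
    by_cases hj : π j = 0
    · simp [ho, hj, he]
    · simp [ho, h01 _ hj, he]
  have hcard : 2 * ∑ j, o j = (Fintype.card G : ℤ) := by
    have h := sum_sub_left_eq e o
    simp only [ho_sub, Finset.sum_sub_distrib, Finset.sum_const, Finset.card_univ,
      nsmul_eq_mul, mul_one] at h
    linarith
  have ha_split : ∀ j, a j = a e * o j + (1 - o j) * a j := fun j => by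
    by_cases hj : π j = 0
    · simp [ho, hj]
    · simp [ho, hj, hconst j (h01 _ hj)]
  -- Exactly one of `j`, `e - j` lies off the kernel of `π`, where `a` equals `a e`.
  have hEo : ∑ j, a j * a (e - j) = 2 * (a e * ∑ j, (1 - o j) * a j) := by
    have hterm : ∀ j, a j * a (e - j) =
        a e * ((1 - o j) * a j) + a e * ((1 - o (e - j)) * a (e - j)) := fun j => by
      by_cases hj : π j = 0
      · have h : π (e - j) = 1 := by simp [hj, he]
        rw [ho_sub, hconst _ h]
        simp only [ho, hj, if_true]
        ring
      · rw [ho_sub, hconst _ (h01 _ hj)]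
        simp only [ho, hj, if_false]
        ring
    rw [Finset.sum_congr rfl fun j _ => hterm j, Finset.sum_add_distrib,
      sum_sub_left_eq e (fun j => a e * ((1 - o j) * a j)), ← Finset.mul_sum]
    ring
  have hE : ∑ j, (1 - o j) * a j = -d := by
    have h := hre e (hne e he)
    rw [hEo] at h
    rcases ha e (hne e he) with h' | h' <;> rw [h'] at h <;> linarith
  have hsum : ∑ j, a j = a e * ∑ j, o j - d := by
    rw [Finset.sum_congr rfl fun j _ => ha_split j, Finset.sum_add_distrib, ← Finset.mul_sum, hE]
    ring
  have hsq := sq_sum_of_real_conv (2 * d) a ha0 ha ha_neg hre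
  have hcpos : (0 : ℤ) < Fintype.card G := by exact_mod_cast Fintype.card_pos (α := G)
  have hm : ∑ j, o j = d + 1 := by
    rw [hsum, ← hcard] at hsq
    have hae : a e ^ 2 = 1 := by
      rcases ha e (hne e he) with h | h <;> rw [h] <;> norm_num
    -- Completing the square in `hsq`, with the cardinality equal to `2 * ∑ j, o j`.
    have h : (∑ j, o j - 1) ^ 2 = d ^ 2 := by
      linear_combination hsq - (∑ j, o j) ^ 2 * hae
    rcases sq_eq_sq_iff_eq_or_eq_neg.mp h with h | h
    · linarith
    · have : d = 0 := by omega
      omega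
  refine ⟨by linarith, ha e (hne e he), fun j hj => ?_⟩
  split_ifs with hπ
  · have hnn : ∀ i ∈ ({0}ᶜ : Finset G), 0 ≤ (1 - o i) * (a i + 1) := fun i hi => by
      refine mul_nonneg ?_ ?_
      · simp only [ho]
        split_ifs <;> norm_num
      · rcases ha i (by simpa using hi) with h | h <;> rw [h] <;> norm_num
    -- The term at `0` is already 1, as `a 0 = 0`, so the other nonnegative terms vanish.
    have htot : ∑ i, (1 - o i) * (a i + 1) = 1 := by
      simp only [mul_add, mul_one, Finset.sum_add_distrib, hE, Finset.sum_sub_distrib,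
        Finset.sum_const, Finset.card_univ, nsmul_eq_mul, mul_one]
      linarith
    rw [← Finset.sum_add_sum_compl ({0} : Finset G), Finset.sum_singleton] at htot
    have hz : ∑ i ∈ ({0}ᶜ : Finset G), (1 - o i) * (a i + 1) = 0 := by
      simp only [ho, map_zero, if_true, ha0] at htot ⊢
      linarith
    have h := (Finset.sum_eq_zero_iff_of_nonneg hnn).mp hz j (by simpa using hj)
    simp only [ho, hπ, if_true] at h
    linarith
  · exact hconst j (h01 _ hπ)

end Convolution

/-! ### Circulant matrices and the main theorem -/

/-- The parity character of `Fin n`, for even `n`. -/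
def finParity {n : ℕ} [NeZero n] (h : 2 ∣ n) : Fin n →+ ZMod 2 where
  toFun j := (j.val : ZMod 2)
  map_zero' := by simp
  map_add' i j := by
    rw [← Nat.cast_add, Fin.val_add, ZMod.natCast_eq_natCast_iff', Nat.mod_mod_of_dvd _ h]

theorem finParity_eq_zero_iff {n : ℕ} [NeZero n] (h : 2 ∣ n) (j : Fin n) :
    finParity h j = 0 ↔ 2 ∣ j.val :=
  ZMod.natCast_eq_zero_iff j.val 2

theorem conj_of_circ_isHermitian {n : ℕ} [NeZero n] {c : Fin n → ℂ} (h : (circ c).IsHermitian)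
    (j : Fin n) : c (-j) = star (c j) := by
  have := h.apply j 0
  simpa [circ, Matrix.circulant_apply] using this.symm

theorem sum_mul_eq_zero_of_orthogonal {n : ℕ} [NeZero n] {c : Fin n → ℂ} {x : ℂ}
    (hneg : ∀ j, c (-j) = star (c j))
    (h : circ c * (circ c).conjTranspose = x • (1 : Matrix (Fin n) (Fin n) ℂ))
    {k : Fin n} (hk : k ≠ 0) : ∑ j, c j * c (k - j) = 0 := by
  have h0 := congrFun (congrFun h 0) k
  rw [Matrix.mul_apply, Matrix.smul_apply, Matrix.one_apply_ne hk.symm, smul_zero] at h0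
  rw [← h0]
  refine Finset.sum_congr rfl fun j _ => ?_
  rw [Matrix.conjTranspose_apply, circ, Matrix.transpose_apply, Matrix.transpose_apply,
    Matrix.circulant_apply, Matrix.circulant_apply, sub_zero, ← hneg, neg_sub]

/-- Integer coordinates of a fourth root of unity, with value `0` when `p` holds. -/
theorem exists_int_parts {p : Prop} {z : ℂ}
    (h : ¬p → z ∈ ({1, -1, Complex.I, -Complex.I} : Set ℂ)) :
    ∃ a b : ℤ, (p → a = 0) ∧ (p → b = 0) ∧ (¬p → z = a + b * Complex.I) ∧
      (¬p → a ^ 2 + b ^ 2 = 1) := by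
  by_cases hp : p
  · exact ⟨0, 0, fun _ => rfl, fun _ => rfl, absurd hp, absurd hp⟩
  · rcases h hp with rfl | rfl | rfl | rfl
    · exact ⟨1, 0, by simp [hp]⟩
    · exact ⟨-1, 0, by simp [hp]⟩
    · exact ⟨0, 1, by simp [hp]⟩
    · exact ⟨0, -1, by simp [hp]⟩

theorem mainTheorem1 (n : ℕ) [NeZero n] (hn : 2 ≤ n) (d : ℝ)
    (hd : ¬ ∃ m : ℤ, Odd m ∧ d = (m : ℝ))
    (c : Fin n → ℂ)
    (hcond : CircConditions d c)
    (hherm : (circ c).IsHermitian)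
    (hroots : ∀ j : Fin n, j ≠ 0 →
      c j ∈ ({1, -1, Complex.I, -Complex.I} : Set ℂ)) :
    (n : ℝ) = 2 * d + 2 ∧
    (∀ i j : Fin n, (circ c i j).im = 0) ∧
    ((∃ m : ℤ, Even m ∧ d = (m : ℝ)) →
      circ c = circ (genNeg n d) ∨ circ c = circ (genAlt n d)) ∧
    ((∃ m : ℤ, d = (m : ℝ) + 1 / 2) →
      circ c = circ (genNeg n d)) := by
  have hneg : ∀ j, c (-j) = star (c j) := conj_of_circ_isHermitian hherm
  choose a b ha0 hb0 hc hab using fun j : Fin n => exists_int_parts (z := c j) (hroots j)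
  replace ha0 := ha0 0 rfl
  replace hb0 := hb0 0 rfl
  have hparts : ∀ j, a (-j) = a j ∧ b (-j) = -b j := fun j => by
    by_cases hj : j = 0
    · simp [hj, ha0, hb0]
    · have h := hneg j
      rw [hc j hj, hc (-j) (neg_ne_zero.mpr hj)] at h
      have h1 := congrArg Complex.re h
      have h2 := congrArg Complex.im h
      simp at h1 h2
      exact ⟨by exact_mod_cast h1, by exact_mod_cast h2⟩
  -- The terms `j = 0` and `j = k` each contribute `d * c k`.
  have hconv : ∀ k, k ≠ 0 → 2 * (d : ℂ) * c k +
      ∑ j, ((a j : ℂ) + b j * Complex.I) * ((a (k - j) : ℂ) + b (k - j) * Complex.I) = 0 :=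
    fun k hk => by
      have h := sum_mul_eq_zero_of_orthogonal hneg hcond.orthogonal hk
      rw [← Finset.sum_add_sum_compl ({0, k} : Finset (Fin n)), Finset.sum_pair hk.symm] at h ⊢
      have hterm : ∀ j ∈ ({0, k}ᶜ : Finset (Fin n)), c j * c (k - j) =
          ((a j : ℂ) + b j * Complex.I) * ((a (k - j) : ℂ) + b (k - j) * Complex.I) :=
        fun j hj => by
          simp only [Finset.mem_compl, Finset.mem_insert, Finset.mem_singleton, not_or] at hj
          rw [hc j hj.1, hc (k - j) (fun h => hj.2 (sub_eq_zero.mp h).symm)]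
      rw [Finset.sum_congr rfl hterm, sub_zero, sub_self, hcond.diag] at h
      simp only [sub_zero, sub_self, ha0, hb0]
      push_cast
      linear_combination h
  have hreR : ∀ k, k ≠ 0 → 2 * d * a k +
      ((∑ j, (a j * a (k - j) - b j * b (k - j)) : ℤ) : ℝ) = 0 := fun k hk => by
    have h := congrArg Complex.re (hconv k hk)
    rw [hc k hk] at h
    simpa [Complex.re_sum] using h
  have himR : ∀ k, k ≠ 0 → 2 * d * b k +
      ((∑ j, (a j * b (k - j) + b j * a (k - j)) : ℤ) : ℝ) = 0 := fun k hk => by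
    have h := congrArg Complex.im (hconv k hk)
    rw [hc k hk] at h
    simpa [Complex.im_sum] using h
  have : Nontrivial (Fin n) := Fin.nontrivial_iff_two_le.mpr hn
  obtain ⟨l, hl⟩ := exists_ne (0 : Fin n)
  obtain ⟨D, hD⟩ : ∃ D : ℤ, 2 * d = D := by
    have h1 := hreR l hl
    have h2 := himR l hl
    have h3 : (a l : ℝ) ^ 2 + (b l : ℝ) ^ 2 = 1 := by exact_mod_cast hab l hl
    generalize (∑ j, (a j * a (l - j) - b j * b (l - j))) = x at h1
    generalize (∑ j, (a j * b (l - j) + b j * a (l - j))) = y at h2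
    -- Multiply `2 * d * c l = -(x + y * I)` by the conjugate of `c l`, which has modulus 1.
    refine ⟨-(x * a l + y * b l), ?_⟩
    push_cast
    linear_combination a l * h1 + b l * h2 - 2 * d * h3
  have hre : ∀ k, k ≠ 0 → D * a k + ∑ j, (a j * a (k - j) - b j * b (k - j)) = 0 :=
    fun k hk => by
      have h := hreR k hk
      rw [hD] at h
      exact_mod_cast h
  have hD0 : 0 ≤ D := by
    have h : (0 : ℝ) ≤ D := by rw [← hD]; linarith [hcond.nonneg]
    exact_mod_cast h
  have hcard : Fintype.card (Fin n) = n := Fintype.card_fin n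
  have hcirc_real : (∀ j, b j = 0) → ∀ i j : Fin n, (circ c i j).im = 0 := fun hb i j => by
    rw [circ, Matrix.transpose_apply, Matrix.circulant_apply]
    by_cases hj : j - i = 0
    · simp [hj, hcond.diag]
    · simp [hc _ hj, hb]
  have hgen : (∀ j, j ≠ 0 → a j = -1) → (∀ j, b j = 0) → circ c = circ (genNeg n d) :=
    fun ha hb => by
      congr 1
      funext j
      by_cases hj : j = 0
      · simp [hj, genNeg, hcond.diag]
      · simp [genNeg, hj, hc j hj, ha j hj, hb]
  rcases Nat.even_or_odd n with heven | hodd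
  · have hm : (⟨n / 2, by omega⟩ : Fin n) ≠ 0 := by
      rw [Ne, Fin.ext_iff, Fin.val_zero]
      simp only
      omega
    have hm2 : -(⟨n / 2, by omega⟩ : Fin n) = ⟨n / 2, by omega⟩ := by
      rw [neg_eq_iff_add_eq_zero, Fin.ext_iff, Fin.val_add, Fin.val_zero]
      obtain ⟨p, rfl⟩ := heven
      simp only
      rw [show (p + p) / 2 + (p + p) / 2 = p + p by omega, Nat.mod_self]
    obtain ⟨⟨e, rfl⟩, hb, ha⟩ := even_and_real_of_involution hm hm2 (by rwa [hcard]) D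
      (fun q hq => by
        by_contra h
        refine hd ⟨q, Int.not_even_iff_odd.mp h, ?_⟩
        rw [hq] at hD
        push_cast at hD
        linarith)
      a b ha0 hb0 hab (fun j => (hparts j).2) hre
    have hde : d = ((2 * e : ℤ) : ℝ) := by
      push_cast at hD ⊢
      linarith
    obtain ⟨hn', h1, hall⟩ := eq_of_real_conv (finParity heven.two_dvd) (e := ⟨1, hn⟩)
      (by simp [finParity]) (2 * e) (even_two_mul e) (by omega) a ha0 ha (fun j => (hparts j).1)
      (fun k hk => by
        have h := hre k hk
        simp only [hb, mul_zero, sub_zero] at h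
        linarith)
    rw [hcard] at hn'
    refine ⟨?_, hcirc_real hb, fun _ => ?_, ?_⟩
    · rw [hde]
      exact_mod_cast hn'
    · rcases h1 with h1 | h1
      · right
        congr 1
        funext j
        by_cases hj : j = 0
        · simp [hj, genAlt, hcond.diag]
        · rw [hc j hj, hall j hj, h1, hb]
          rcases Nat.mod_two_eq_zero_or_one j.val with h | h
          · have hp : finParity heven.two_dvd j = 0 :=
              (finParity_eq_zero_iff _ _).mpr (Nat.dvd_of_mod_eq_zero h)
            simp [genAlt, hj, hp, h]
          · have hp : finParity heven.two_dvd j ≠ 0 := fun hp => by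
              have := (finParity_eq_zero_iff _ _).mp hp
              omega
            simp [genAlt, hj, hp, h]
      · left
        exact hgen (fun j hj => by rw [hall j hj, h1, ite_self]) hb
    -- For even `n`, `d` is an integer, so the half-integer case is void.
    · rintro ⟨m, hm'⟩
      exfalso
      have h : (2 * (2 * e) : ℝ) = 2 * m + 1 := by
        rw [hde] at hm'
        push_cast at hm'
        linarith
      have h' : 2 * (2 * e) = 2 * m + 1 := by exact_mod_cast h
      omega
  · obtain ⟨hn', hall⟩ := eq_neg_one_of_odd_card (by rwa [hcard]) (by rwa [hcard]) D hD0 a b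
      ha0 hb0 hab hre
    rw [hcard] at hn'
    have hb : ∀ j, b j = 0 := fun j => by
      by_cases hj : j = 0
      · rw [hj, hb0]
      · exact (hall j hj).2
    have hg := hgen (fun j hj => (hall j hj).1) hb
    refine ⟨?_, hcirc_real hb, fun _ => Or.inl hg, fun _ => hg⟩
    rw [hD]
    exact_mod_cast hn'
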